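/- Let $d_A, d_B$ be positive integers with $d = \min(d_A, d_B) \ge 2$, let $\alpha, \beta$ be real numbers and let $l \ge 0$ be an integer. For a square matrix $X = (x_{ij})$ let $\operatorname{vec}(X)$ be the column vector obtained by stacking the columns of $X$, and let $\omega_l(X) = (\operatorname{vec}(X), \ldots, \operatorname{vec}(X))$ with $l$ equal columns. For a $d_A d_B \times d_A d_B$ matrix $\rho$ acting on $\mathbb{C}^{d_A} \otimes \mathbb{C}^{d_B}$, regarded as a $d_A \times d_A$ block matrix with blocks $\rho_{i,j} \in \mathbb{C}^{d_B \times d_B}$, let $\mathcal{R}(\rho)$ be the $d_A^2 \times d_B^2$ realigned matrix whose rows are $\operatorname{vec}(\rho_{1,1})^T, \ldots, \operatorname{vec}(\rho_{d_A,1})^T, \ldots, \operatorname{vec}(\rho_{1,d_A})^T, \ldots, \operatorname{vec}(\rho_{d_A,d_A})^T$, and put $$\mathcal{M}^l_{\alpha,\beta}(\rho) = \begin{pmatrix} \alpha\beta E_{l\times l} & \alpha\, \omega_l(\operatorname{tr}_A \rho)^T \\ \beta\, \omega_l(\operatorname{tr}_B \rho) & \mathcal{R}(\rho) \end{pmatrix},$$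 where $E_{l\times l}$ is the all-ones matrix and $\operatorname{tr}_A, \operatorname{tr}_B$ are the partial traces over the first and the second tensor factor. Let $\|X\|_{tr} = \operatorname{tr}\sqrt{X^\dagger X}$ be the trace norm. The concurrence of a unit vector $|\varphi\rangle \in \mathbb{C}^{d_A} \otimes \mathbb{C}^{d_B}$ is $C(|\varphi\rangle) = \sqrt{2(1 - \operatorname{tr}(\rho_A^2))}$ with $\rho_A = \operatorname{tr}_B |\varphi\rangle\langle\varphi|$, and the concurrence $C(\rho)$ of a density matrix $\rho$ (positive semidefinite, trace $1$) is the minimum (infimum) of $\sum_i p_i C(|\varphi_i\rangle)$ over all finite decompositions $\rho = \sum_i p_i |\varphi_i\rangle\langle\varphi_i|$ with $p_i \ge 0$, $\sum_i p_i = 1$ and unit vectors $|\varphi_i\rangle$. Then every density matrix $\rho$ on $\mathbb{C}^{d_A} \otimes \mathbb{C}^{d_B}$ satisfies $$C(\rho) \ge \frac{\sqrt{2}}{\sqrt{d(d-1)}} \left( \left\|\mathcal{M}^l_{\alpha,\beta}(\rho)\right\|_{tr} - \sqrt{(l\alpha^2+1)(l\beta^2+1)} \right).$$ -/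

import Mathlib

noncomputable section

namespace Bipartite

open scoped Matrix MatrixOrder ComplexOrder

/-- A density matrix (quantum state): positive semidefinite with unit trace. -/
def IsDensity {n : Type*} [Fintype n] (ρ : Matrix n n ℂ) : Prop :=
  ρ.PosSemidef ∧ ρ.trace = 1

/-- The trace norm `tr √(A† A)`. The trace of the positive semidefinite matrix `√(A† A)` is a
nonnegative real number; `re` only turns it into an element of `ℝ`. -/
def traceNorm {m n : Type*} [Fintype m] [Fintype n] [DecidableEq n] (A : Matrix m n ℂ) : ℝ :=
  (CFC.sqrt (Aᴴ * A)).trace.re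

section

variable {dA dB : ℕ}

/-- The partial trace over the first subsystem. -/
def ptraceA (ρ : Matrix (Fin dA × Fin dB) (Fin dA × Fin dB) ℂ) : Matrix (Fin dB) (Fin dB) ℂ :=
  Matrix.of fun k l => ∑ i, ρ (i, k) (i, l)

/-- The partial trace over the second subsystem. -/
def ptraceB (ρ : Matrix (Fin dA × Fin dB) (Fin dA × Fin dB) ℂ) : Matrix (Fin dA) (Fin dA) ℂ :=
  Matrix.of fun i j => ∑ k, ρ (i, k) (j, k)

/-- The block `Z_{i,j}` of a `dA × dA` block matrix with blocks of size `dB × dB`. -/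
def block (Z : Matrix (Fin dA × Fin dB) (Fin dA × Fin dB) ℂ) (i j : Fin dA) :
    Matrix (Fin dB) (Fin dB) ℂ :=
  Matrix.of fun k l => Z (i, k) (j, l)

/-- The realigned matrix, whose rows are `vec(Z_{i,j})ᵀ`. As in `Matrix.vec` (column stacking),
the pair `(j, i)` labels the position of the entry or block `(i, j)`, so the rows are in the order
`Z_{1,1}, …, Z_{m,1}, …, Z_{1,m}, …, Z_{m,m}`. -/
def realign (Z : Matrix (Fin dA × Fin dB) (Fin dA × Fin dB) ℂ) :
    Matrix (Fin dA × Fin dA) (Fin dB × Fin dB) ℂ :=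
  Matrix.of fun r => (block Z r.2 r.1).vec

/-- `ω_l(X) = (vec X, …, vec X)`, with `l` equal columns. -/
def omega (l : ℕ) {n : ℕ} (X : Matrix (Fin n) (Fin n) ℂ) : Matrix (Fin n × Fin n) (Fin l) ℂ :=
  Matrix.of fun r _ => X.vec r

/-- The block matrix
`[[αβ E_{l×l}, α ω_l(tr_A ρ)ᵀ], [β ω_l(tr_B ρ), R(ρ)]]`. -/
def M (α β : ℝ) (l : ℕ) (ρ : Matrix (Fin dA × Fin dB) (Fin dA × Fin dB) ℂ) :
    Matrix (Fin l ⊕ Fin dA × Fin dA) (Fin l ⊕ Fin dB × Fin dB) ℂ :=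
  Matrix.fromBlocks
    (((α * β : ℝ) : ℂ) • Matrix.of fun _ _ => 1) ((α : ℂ) • (omega l (ptraceA ρ))ᵀ)
    ((β : ℂ) • omega l (ptraceB ρ)) (realign ρ)

/-- The rank one matrix `|φ⟩⟨φ|`. -/
def proj (φ : EuclideanSpace ℂ (Fin dA × Fin dB)) :
    Matrix (Fin dA × Fin dB) (Fin dA × Fin dB) ℂ :=
  Matrix.of fun x y => φ x * star (φ y)

/-- The concurrence `√(2 (1 - tr ρ_A²))`, `ρ_A = tr_B |φ⟩⟨φ|`, of a pure state `φ`. The trace of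
the square of the Hermitian matrix `ρ_A` is real. -/
def pureConcurrence (φ : EuclideanSpace ℂ (Fin dA × Fin dB)) : ℝ :=
  √(2 * (1 - (ptraceB (proj φ) ^ 2).trace.re))

/-- `(p_i, φ_i)` is an ensemble of pure states with `ρ = ∑ p_i |φ_i⟩⟨φ_i|`. -/
structure IsEnsemble (ρ : Matrix (Fin dA × Fin dB) (Fin dA × Fin dB) ℂ) {n : ℕ}
    (p : Fin n → ℝ) (φ : Fin n → EuclideanSpace ℂ (Fin dA × Fin dB)) : Prop where
  nonneg : ∀ i, 0 ≤ p i
  sum_eq_one : ∑ i, p i = 1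
  norm_eq_one : ∀ i, ‖φ i‖ = 1
  sum_proj : ρ = ∑ i, (p i : ℂ) • proj (φ i)

/-- The averages `∑ p_i C(φ_i)` over all ensembles of pure states that realize `ρ`. -/
def averages (ρ : Matrix (Fin dA × Fin dB) (Fin dA × Fin dB) ℂ) : Set ℝ :=
  {c | ∃ (n : ℕ) (p : Fin n → ℝ) (φ : Fin n → EuclideanSpace ℂ (Fin dA × Fin dB)),
    IsEnsemble ρ p φ ∧ c = ∑ i, p i * pureConcurrence (φ i)}

/-- The concurrence of a mixed state: the smallest average over the ensembles that realize it. -/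
def concurrence (ρ : Matrix (Fin dA × Fin dB) (Fin dA × Fin dB) ℂ) : ℝ :=
  sInf (averages ρ)

/-- The averages are nonnegative, so they are bounded below. -/
theorem averages_bddBelow (ρ : Matrix (Fin dA × Fin dB) (Fin dA × Fin dB) ℂ) :
    BddBelow (averages ρ) := by
  refine ⟨0, ?_⟩
  rintro c ⟨n, p, φ, h, rfl⟩
  exact Finset.sum_nonneg fun i _ => mul_nonneg (h.nonneg i) (Real.sqrt_nonneg _)

/-- A density matrix is realized by an ensemble of its eigenvectors. -/
theorem averages_nonempty {ρ : Matrix (Fin dA × Fin dB) (Fin dA × Fin dB) ℂ}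
    (hρ : IsDensity ρ) : (averages ρ).Nonempty := by
  have hH := hρ.1.isHermitian
  let e : Fin (Fintype.card (Fin dA × Fin dB)) ≃ Fin dA × Fin dB := (Fintype.equivFin _).symm
  refine ⟨_, _, fun i => hH.eigenvalues (e i), fun i => hH.eigenvectorBasis (e i),
    ⟨fun i => hρ.1.eigenvalues_nonneg _, ?_, fun i => hH.eigenvectorBasis.norm_eq_one _, ?_⟩, rfl⟩
  · rw [e.sum_comp (fun j => hH.eigenvalues j)]
    have h := hH.trace_eq_sum_eigenvalues
    rw [hρ.2] at h
    have h2 := congrArg Complex.re h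
    simpa using h2.symm
  · rw [e.sum_comp (fun j => (hH.eigenvalues j : ℂ) • proj (hH.eigenvectorBasis j))]
    have h := hH.spectral_theorem
    ext x y
    conv_lhs => rw [h]
    simp [Unitary.conjStarAlgAut_apply, Matrix.mul_apply, Matrix.diagonal_apply, Matrix.sum_apply,
      proj, Matrix.star_apply, mul_comm, mul_assoc, Matrix.IsHermitian.eigenvectorUnitary_apply]

end

end Bipartite

end

/-! The trace norm of `M α β l ρ` equals its pairing with a partial isometry
(`exists_traceNorm_eq_pairing`). For any ensemble of `ρ`, that pairing is the average of the
pairings with the pure-state matrices, so it suffices to bound each of these by the pure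
concurrence. For a pure state with Schmidt coefficients `s r`, `M_proj_eq_sum` writes the matrix as
a sum of rank-one terms with weights `s r * s t`. Write `K = √((l α² + 1)(l β² + 1))`. Terms with `r
= t` carry the border and have norm `K`; the others have norm `1`. Since `∑ s r ^ 2 = 1`, the
pairing is at most `K + ∑_{r ≠ t} s r * s t`. Cauchy–Schwarz over the at most `d (d - 1)`
off-diagonal pairs compares this last sum with `√(1 - ∑ s r ^ 4)`, which is the pure concurrence up
to `√2`. -/

noncomputable section

namespace Bipartite
open scoped Matrix MatrixOrder ComplexOrder

/-! ### Singular values. -/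

/-- A singular value decomposition, restricted to the nonzero singular values. -/
theorem exists_svd {m n : Type} [Fintype m] [Fintype n] [DecidableEq n] (A : Matrix m n ℂ) :
    ∃ (ι : Type) (_ : Fintype ι) (s : ι → ℝ) (u : ι → EuclideanSpace ℂ m)
      (v : ι → EuclideanSpace ℂ n), (∀ r, 0 ≤ s r) ∧ Orthonormal ℂ u ∧ Orthonormal ℂ v ∧
      (∀ i j, A i j = ∑ r, (s r : ℂ) * u r i * star (v r j)) ∧ traceNorm A = ∑ r, s r := by
  classical
  have hH : 0 ≤ Aᴴ * A := (Matrix.posSemidef_conjTranspose_mul_self A).nonneg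
  set P := CFC.sqrt (Aᴴ * A) with hPdef
  have hP : P.PosSemidef := Matrix.nonneg_iff_posSemidef.1 (CFC.sqrt_nonneg _)
  have hPP : P * P = Aᴴ * A := CFC.sqrt_mul_sqrt_self _ hH
  set b := hP.isHermitian.eigenvectorBasis with hb
  set σ := hP.isHermitian.eigenvalues with hσ
  let w : n → EuclideanSpace ℂ m := fun k => WithLp.toLp 2 (A *ᵥ (b k).ofLp)
  have hPb (k) : P *ᵥ (b k).ofLp = σ k • (b k).ofLp :=
    hP.isHermitian.mulVec_eigenvectorBasis k
  have hw (j k) : inner ℂ (w j) (w k) = if j = k then (σ k : ℂ) ^ 2 else 0 := by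
    have h1 : inner ℂ (w j) (w k) = (σ k : ℂ) ^ 2 * inner ℂ (b j) (b k) := by
      simp only [w, EuclideanSpace.inner_eq_star_dotProduct]
      rw [Matrix.star_mulVec, dotProduct_comm, ← Matrix.dotProduct_mulVec, Matrix.mulVec_mulVec,
        ← hPP, ← Matrix.mulVec_mulVec, hPb, Matrix.mulVec_smul, hPb, dotProduct_smul,
        dotProduct_smul, dotProduct_comm, Complex.real_smul, Complex.real_smul]
      ring
    rw [h1, orthonormal_iff_ite.1 b.orthonormal]
    split_ifs <;> simp
  have hA (i j) : A i j = ∑ k, w k i * star (b k j) := by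
    have h1 : (hP.isHermitian.eigenvectorUnitary : Matrix n n ℂ) *
        star (hP.isHermitian.eigenvectorUnitary : Matrix n n ℂ) = 1 :=
      Unitary.coe_mul_star_self _
    have h2 : A = (A * (hP.isHermitian.eigenvectorUnitary : Matrix n n ℂ)) *
        star (hP.isHermitian.eigenvectorUnitary : Matrix n n ℂ) := by
      rw [Matrix.mul_assoc, h1, Matrix.mul_one]
    conv_lhs => rw [h2]
    simp [Matrix.mul_apply, Matrix.star_apply, w, Matrix.mulVec, dotProduct, b,
      Matrix.IsHermitian.eigenvectorUnitary_apply]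
  -- Since `‖w k‖ = σ k`, zero singular values contribute nothing; dropping them lets the remaining
  -- `w k` be normalized.
  have hw0 (k) (hk : σ k = 0) : w k = 0 := by
    have := hw k k
    rw [hk] at this
    simpa using this
  refine ⟨{k // σ k ≠ 0}, inferInstance, fun r => σ r, fun r => ((σ r : ℂ)⁻¹) • w r,
    fun r => b r, fun r => hP.eigenvalues_nonneg r, ?_, ?_, ?_, ?_⟩
  · rw [orthonormal_iff_ite]
    rintro ⟨j, hj⟩ ⟨k, hk⟩
    have hk' : (σ k : ℂ) ≠ 0 := by exact_mod_cast hk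
    rw [inner_smul_left, inner_smul_right, hw]
    by_cases h : j = k
    · subst h
      simp
      field_simp
    · simp [h]
  · exact b.orthonormal.comp _ Subtype.val_injective
  · intro i j
    rw [hA, ← Fintype.sum_subtype_add_sum_subtype (fun k => σ k ≠ 0)]
    rw [Finset.sum_eq_zero (s := (Finset.univ : Finset {k // ¬ σ k ≠ 0})), add_zero]
    · refine Finset.sum_congr rfl fun r _ => ?_
      have hk' : (σ r : ℂ) ≠ 0 := by exact_mod_cast r.2
      simp [hk']
    · intro r _
      rw [hw0 r (not_not.1 r.2)]
      simp
  · have h1 : traceNorm A = ∑ k, σ k := by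
      have := congrArg Complex.re hP.isHermitian.trace_eq_sum_eigenvalues
      simpa [traceNorm, ← hPdef] using this
    rw [h1, ← Fintype.sum_subtype_add_sum_subtype (fun k => σ k ≠ 0)]
    rw [Finset.sum_eq_zero (s := (Finset.univ : Finset {k // ¬ σ k ≠ 0})), add_zero]
    intro r _
    exact not_not.1 r.2

/-! ### Duality for the trace norm. -/

/-- The pairing `Re ∑ ⟨u_r, A v_r⟩` of a matrix with the partial isometry `∑ u_r v_r†`. -/
def pairing {ι m n : Type} [Fintype ι] [Fintype m] [Fintype n] (u : ι → EuclideanSpace ℂ m)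
    (v : ι → EuclideanSpace ℂ n) (A : Matrix m n ℂ) : ℝ :=
  (∑ r, ∑ i, ∑ j, star (u r i) * A i j * v r j).re

section pairing

variable {ι m n : Type} [Fintype ι] [Fintype m] [Fintype n] (u : ι → EuclideanSpace ℂ m)
    (v : ι → EuclideanSpace ℂ n)

theorem pairing_sum_smul {κ : Type} [Fintype κ] (p : κ → ℝ) (A : κ → Matrix m n ℂ) :
    pairing u v (∑ k, (p k : ℂ) • A k) = ∑ k, p k * pairing u v (A k) := by
  have key (r i j) : star (u r i) * (∑ k, (p k : ℂ) • A k) i j * v r j =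
      ∑ k, (p k : ℂ) * (star (u r i) * A k i j * v r j) := by
    simp only [Matrix.sum_apply, Finset.mul_sum, Finset.sum_mul, Matrix.smul_apply, smul_eq_mul]
    exact Finset.sum_congr rfl fun k _ => by ring
  simp only [pairing, key]
  simp_rw [Finset.sum_comm (s := (Finset.univ : Finset n)) (t := (Finset.univ : Finset κ)),
    Finset.sum_comm (s := (Finset.univ : Finset m)) (t := (Finset.univ : Finset κ)),
    Finset.sum_comm (s := (Finset.univ : Finset ι)) (t := (Finset.univ : Finset κ)),
    ← Finset.mul_sum]
  simp [Complex.re_sum]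

variable {u v}

/-- On a rank-one matrix the pairing splits into products of inner products; Cauchy–Schwarz over
`r`, then Bessel's inequality for each family, gives the bound. -/
theorem pairing_vecMulVec_le (hu : Orthonormal ℂ u) (hv : Orthonormal ℂ v)
    (x : m → ℂ) (y : n → ℂ) :
    pairing u v (Matrix.vecMulVec x y) ≤ √(∑ i, ‖x i‖ ^ 2) * √(∑ j, ‖y j‖ ^ 2) := by
  have h1 : ∑ r, ∑ i, ∑ j, star (u r i) * Matrix.vecMulVec x y i j * v r j =
      ∑ r, inner ℂ (u r) (WithLp.toLp 2 x) * inner ℂ (WithLp.toLp 2 (star y)) (v r) := by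
    refine Finset.sum_congr rfl fun r _ => ?_
    simp only [PiLp.inner_apply, Finset.sum_mul_sum, Matrix.vecMulVec_apply]
    refine Finset.sum_congr rfl fun i _ => Finset.sum_congr rfl fun j _ => ?_
    simp
    ring
  have hx : ∑ r, ‖inner ℂ (u r) (WithLp.toLp 2 x)‖ ^ 2 ≤ ∑ i, ‖x i‖ ^ 2 := by
    refine (hu.sum_inner_products_le _).trans_eq ?_
    simp [EuclideanSpace.norm_sq_eq]
  have hy : ∑ r, ‖inner ℂ (WithLp.toLp 2 (star y)) (v r)‖ ^ 2 ≤ ∑ j, ‖y j‖ ^ 2 := by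
    simp_rw [norm_inner_symm (𝕜 := ℂ) (WithLp.toLp 2 (star y))]
    refine (hv.sum_inner_products_le _).trans_eq ?_
    simp [EuclideanSpace.norm_sq_eq]
  calc pairing u v (Matrix.vecMulVec x y)
      ≤ ‖∑ r, inner ℂ (u r) (WithLp.toLp 2 x) * inner ℂ (WithLp.toLp 2 (star y)) (v r)‖ := by
        rw [pairing, h1]
        exact Complex.re_le_norm _
    _ ≤ ∑ r, ‖inner ℂ (u r) (WithLp.toLp 2 x)‖ * ‖inner ℂ (WithLp.toLp 2 (star y)) (v r)‖ := by
        refine (norm_sum_le _ _).trans_eq ?_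
        simp_rw [norm_mul]
    _ ≤ _ := (Real.sum_mul_le_sqrt_mul_sqrt _ _ _).trans <|
        mul_le_mul (Real.sqrt_le_sqrt hx) (Real.sqrt_le_sqrt hy) (Real.sqrt_nonneg _)
          (Real.sqrt_nonneg _)

end pairing

/-- The trace norm is attained as a pairing with a partial isometry. -/
theorem exists_traceNorm_eq_pairing {m n : Type} [Fintype m] [Fintype n] [DecidableEq n]
    (A : Matrix m n ℂ) :
    ∃ (ι : Type) (_ : Fintype ι) (u : ι → EuclideanSpace ℂ m) (v : ι → EuclideanSpace ℂ n),
      Orthonormal ℂ u ∧ Orthonormal ℂ v ∧ traceNorm A = pairing u v A := by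
  classical
  obtain ⟨ι, _, s, u, v, -, hu, hv, hA, hs⟩ := exists_svd A
  refine ⟨ι, inferInstance, u, v, hu, hv, ?_⟩
  have h1 (r) : ∑ i, ∑ j, star (u r i) * A i j * v r j =
      ∑ t, (s t : ℂ) * (inner ℂ (u r) (u t) * inner ℂ (v t) (v r)) := by
    simp only [PiLp.inner_apply, Finset.sum_mul_sum, hA]
    simp only [Finset.mul_sum, Finset.sum_mul]
    simp_rw [Finset.sum_comm (s := (Finset.univ : Finset n)) (t := (Finset.univ : Finset ι)),
      Finset.sum_comm (s := (Finset.univ : Finset m)) (t := (Finset.univ : Finset ι))]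
    refine Finset.sum_congr rfl fun t _ => Finset.sum_congr rfl fun i _ =>
      Finset.sum_congr rfl fun j _ => ?_
    simp
    ring
  have h2 : ∑ r, ∑ i, ∑ j, star (u r i) * A i j * v r j = ∑ r, (s r : ℂ) := by
    refine Finset.sum_congr rfl fun r _ => ?_
    rw [h1]
    simp [orthonormal_iff_ite.1 hu, orthonormal_iff_ite.1 hv]
  rw [hs, pairing, h2]
  simp

/-! ### Schmidt decomposition. -/

variable {dA dB : ℕ}

/-- The Schmidt decomposition of a bipartite unit vector. -/
theorem exists_schmidt (φ : EuclideanSpace ℂ (Fin dA × Fin dB)) (hφ : ‖φ‖ = 1) :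
    ∃ (ι : Type) (_ : Fintype ι) (s : ι → ℝ) (u : ι → EuclideanSpace ℂ (Fin dA))
      (v : ι → EuclideanSpace ℂ (Fin dB)), (∀ r, 0 ≤ s r) ∧ Orthonormal ℂ u ∧ Orthonormal ℂ v ∧
      (∀ i k, φ (i, k) = ∑ r, (s r : ℂ) * u r i * star (v r k)) ∧ ∑ r, s r ^ 2 = 1 ∧
      Fintype.card ι ≤ min dA dB := by
  classical
  -- The singular values of the coefficient matrix of `φ` are its Schmidt coefficients.
  obtain ⟨ι, _, s, u, v, hs, hu, hv, hA, -⟩ := exists_svd (Matrix.of fun i k => φ (i, k))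
  refine ⟨ι, inferInstance, s, u, v, hs, hu, hv, hA, ?_, le_min ?_ ?_⟩
  · have h1 : (∑ x, star (φ x) * φ x) = 1 := by
      have h := inner_self_eq_norm_sq_to_K (𝕜 := ℂ) φ
      rw [hφ, PiLp.inner_apply] at h
      simpa [Complex.conj_mul'] using h
    have h2 : (∑ x, star (φ x) * φ x) =
        ∑ r, ∑ t, (s r : ℂ) * s t * (inner ℂ (u r) (u t) * inner ℂ (v t) (v r)) := by
      rw [Fintype.sum_prod_type]
      simp only [Matrix.of_apply] at hA
      simp only [PiLp.inner_apply, Finset.sum_mul_sum, hA, star_sum]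
      simp only [Finset.mul_sum]
      simp_rw [Finset.sum_comm (s := (Finset.univ : Finset (Fin dB)))
          (t := (Finset.univ : Finset ι)),
        Finset.sum_comm (s := (Finset.univ : Finset (Fin dA))) (t := (Finset.univ : Finset ι))]
      refine Finset.sum_congr rfl fun r _ => Finset.sum_congr rfl fun t _ =>
        Finset.sum_congr rfl fun i _ => Finset.sum_congr rfl fun j _ => ?_
      simp
      ring
    rw [h2] at h1
    simp [orthonormal_iff_ite.1 hu, orthonormal_iff_ite.1 hv] at h1
    have h3 : ((∑ r, s r ^ 2 : ℝ) : ℂ) = 1 := by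
      rw [← h1]
      push_cast
      exact Finset.sum_congr rfl fun r _ => sq _
    exact_mod_cast h3
  · simpa using hu.linearIndependent.fintype_card_le_finrank
  · simpa using hv.linearIndependent.fintype_card_le_finrank

/-! ### The matrix `M` of a pure state. -/

section pure

variable {ι : Type} [Fintype ι] {s : ι → ℝ} {u : ι → EuclideanSpace ℂ (Fin dA)}
  {v : ι → EuclideanSpace ℂ (Fin dB)} {φ : EuclideanSpace ℂ (Fin dA × Fin dB)}

theorem ptraceB_proj_apply (hv : Orthonormal ℂ v)
    (h : ∀ i k, φ (i, k) = ∑ r, (s r : ℂ) * u r i * star (v r k)) (i j : Fin dA) :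
    ptraceB (proj φ) i j = ∑ r, (s r : ℂ) ^ 2 * (u r i * star (u r j)) := by
  classical
  have h2 : ptraceB (proj φ) i j =
      ∑ r, ∑ t, (s r : ℂ) * s t * (u r i * star (u t j)) * inner ℂ (v r) (v t) := by
    simp only [ptraceB, proj, Matrix.of_apply, h, star_sum, Finset.sum_mul_sum, PiLp.inner_apply]
    simp only [Finset.mul_sum]
    simp_rw [Finset.sum_comm (s := (Finset.univ : Finset (Fin dB)))
      (t := (Finset.univ : Finset ι))]
    refine Finset.sum_congr rfl fun r _ => Finset.sum_congr rfl fun t _ =>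
      Finset.sum_congr rfl fun k _ => ?_
    simp
    ring
  rw [h2]
  simp [orthonormal_iff_ite.1 hv, sq]

theorem ptraceA_proj_apply (hu : Orthonormal ℂ u)
    (h : ∀ i k, φ (i, k) = ∑ r, (s r : ℂ) * u r i * star (v r k)) (k q : Fin dB) :
    ptraceA (proj φ) k q = ∑ r, (s r : ℂ) ^ 2 * (star (v r k) * v r q) := by
  classical
  have h2 : ptraceA (proj φ) k q =
      ∑ r, ∑ t, (s r : ℂ) * s t * (star (v r k) * v t q) * inner ℂ (u t) (u r) := by
    simp only [ptraceA, proj, Matrix.of_apply, h, star_sum, Finset.sum_mul_sum, PiLp.inner_apply]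
    simp only [Finset.mul_sum]
    simp_rw [Finset.sum_comm (s := (Finset.univ : Finset (Fin dA)))
      (t := (Finset.univ : Finset ι))]
    refine Finset.sum_congr rfl fun r _ => Finset.sum_congr rfl fun t _ =>
      Finset.sum_congr rfl fun k _ => ?_
    simp
    ring
  rw [h2]
  simp [orthonormal_iff_ite.1 hu, sq]

theorem trace_ptraceB_proj_sq (hu : Orthonormal ℂ u) (hv : Orthonormal ℂ v)
    (h : ∀ i k, φ (i, k) = ∑ r, (s r : ℂ) * u r i * star (v r k)) :
    (ptraceB (proj φ) ^ 2).trace.re = ∑ r, s r ^ 4 := by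
  classical
  have h2 : (ptraceB (proj φ) ^ 2).trace =
      ∑ r, ∑ t, (s r : ℂ) ^ 2 * (s t : ℂ) ^ 2 * (inner ℂ (u t) (u r) * inner ℂ (u r) (u t)) := by
    simp only [sq (ptraceB (proj φ)), Matrix.trace, Matrix.diag_apply, Matrix.mul_apply,
      ptraceB_proj_apply hv h, Finset.sum_mul_sum, PiLp.inner_apply]
    simp only [Finset.mul_sum]
    simp_rw [Finset.sum_comm (s := (Finset.univ : Finset (Fin dA)))
      (t := (Finset.univ : Finset ι))]
    refine Finset.sum_congr rfl fun r _ => Finset.sum_congr rfl fun t _ =>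
      Finset.sum_congr rfl fun i _ => Finset.sum_congr rfl fun j _ => ?_
    simp
    ring
  rw [h2]
  have h3 : (∑ r, ∑ t, (s r : ℂ) ^ 2 * (s t : ℂ) ^ 2 *
      (inner ℂ (u t) (u r) * inner ℂ (u r) (u t))) = ((∑ r, s r ^ 4 : ℝ) : ℂ) := by
    simp only [orthonormal_iff_ite.1 hu]
    push_cast
    refine Finset.sum_congr rfl fun r _ => ?_
    rw [Finset.sum_eq_single r (fun t _ ht => by simp [ht]) (by simp)]
    simp
    ring
  rw [h3, Complex.ofReal_re]

/-- The vector with `l` entries `a` on top of `x ⊗ y` (in the order of `Matrix.vec`). -/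
def extend (l : ℕ) {n : ℕ} (a : ℂ) (x y : Fin n → ℂ) : Fin l ⊕ Fin n × Fin n → ℂ :=
  Sum.elim (fun _ => a) fun r => x r.2 * y r.1

theorem sum_norm_extend_sq (l : ℕ) {n : ℕ} (a : ℂ) (x y : Fin n → ℂ) :
    ∑ i, ‖extend l a x y i‖ ^ 2 = l * ‖a‖ ^ 2 + (∑ i, ‖x i‖ ^ 2) * ∑ i, ‖y i‖ ^ 2 := by
  simp only [extend, Fintype.sum_sum_type, Sum.elim_inl, Sum.elim_inr, Finset.sum_const,
    Finset.card_univ, Fintype.card_fin, nsmul_eq_mul, Fintype.sum_prod_type_right,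
    Finset.sum_mul_sum, norm_mul, mul_pow]

/-- Realignment turns the `(r, t)` term of `|φ⟩⟨φ|` into a rank-one matrix. The reduced states
involve only `r = t`, so the border is attached to those terms alone; the corner comes out as `α *
β` because `∑ s r ^ 2 = 1`. -/
theorem M_proj_eq_sum [DecidableEq ι] (α β : ℝ) (l : ℕ) (hu : Orthonormal ℂ u)
    (hv : Orthonormal ℂ v) (h1 : ∑ r, s r ^ 2 = 1)
    (h : ∀ i k, φ (i, k) = ∑ r, (s r : ℂ) * u r i * star (v r k)) :
    M α β l (proj φ) = ∑ x : ι × ι, ((s x.1 * s x.2 : ℝ) : ℂ) • Matrix.vecMulVec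
      (extend l (if x.1 = x.2 then (α : ℂ) else 0) (u x.1) (star (u x.2).ofLp))
      (extend l (if x.1 = x.2 then (β : ℂ) else 0) (star (v x.1).ofLp) (v x.2)) := by
  have h1' : (∑ r, (s r : ℂ) ^ 2) = 1 := by exact_mod_cast h1
  ext (a | ⟨a₁, a₂⟩) (b | ⟨b₁, b₂⟩)
  · simp only [M, extend, Matrix.fromBlocks_apply₁₁, Matrix.sum_apply, Matrix.smul_apply,
      Matrix.vecMulVec_apply, Sum.elim_inl, Fintype.sum_prod_type, Matrix.of_apply, smul_eq_mul]
    simp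
    calc (α : ℂ) * β = ∑ r, α * β * (s r : ℂ) ^ 2 := by rw [← Finset.mul_sum, h1', mul_one]
      _ = _ := Finset.sum_congr rfl fun r _ => by ring
  · simp only [M, extend, Matrix.fromBlocks_apply₁₂, Matrix.sum_apply, Matrix.smul_apply,
      Matrix.vecMulVec_apply, Sum.elim_inl, Sum.elim_inr, Fintype.sum_prod_type, Matrix.of_apply,
      smul_eq_mul, omega, Matrix.transpose_apply, Matrix.vec, ptraceA_proj_apply hu h]
    simp
    rw [Finset.mul_sum]
    exact Finset.sum_congr rfl fun r _ => by ring
  · simp only [M, extend, Matrix.fromBlocks_apply₂₁, Matrix.sum_apply, Matrix.smul_apply,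
      Matrix.vecMulVec_apply, Sum.elim_inl, Sum.elim_inr, Fintype.sum_prod_type, Matrix.of_apply,
      smul_eq_mul, omega, Matrix.vec, ptraceB_proj_apply hv h]
    simp
    rw [Finset.mul_sum]
    exact Finset.sum_congr rfl fun r _ => by ring
  · simp only [M, extend, Matrix.fromBlocks_apply₂₂, Matrix.sum_apply, Matrix.smul_apply,
      Matrix.vecMulVec_apply, Sum.elim_inr, Fintype.sum_prod_type, Matrix.of_apply,
      smul_eq_mul, realign, block, Matrix.vec, proj, h, star_sum, Finset.sum_mul_sum]
    refine Finset.sum_congr rfl fun r _ => Finset.sum_congr rfl fun t _ => ?_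
    simp
    ring

theorem pairing_M_proj_le {κ : Type} [Fintype κ]
    {x : κ → EuclideanSpace ℂ (Fin l ⊕ Fin dA × Fin dA)}
    {y : κ → EuclideanSpace ℂ (Fin l ⊕ Fin dB × Fin dB)} (hx : Orthonormal ℂ x)
    (hy : Orthonormal ℂ y) (α β : ℝ) (hs : ∀ r, 0 ≤ s r) (hu : Orthonormal ℂ u)
    (hv : Orthonormal ℂ v) (h1 : ∑ r, s r ^ 2 = 1)
    (h : ∀ i k, φ (i, k) = ∑ r, (s r : ℂ) * u r i * star (v r k)) :
    pairing x y (M α β l (proj φ)) - √((l * α ^ 2 + 1) * (l * β ^ 2 + 1)) ≤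
      (∑ r, s r) ^ 2 - 1 := by
  classical
  set K := √((l * α ^ 2 + 1) * (l * β ^ 2 + 1)) with hK
  have hnu (r) : ∑ i, ‖u r i‖ ^ 2 = 1 := by rw [← EuclideanSpace.norm_sq_eq, hu.1 r]; norm_num
  have hnv (r) : ∑ i, ‖v r i‖ ^ 2 = 1 := by rw [← EuclideanSpace.norm_sq_eq, hv.1 r]; norm_num
  have hb : pairing x y (M α β l (proj φ)) ≤
      ∑ z : ι × ι, s z.1 * s z.2 * if z.1 = z.2 then K else 1 := by
    rw [M_proj_eq_sum α β l hu hv h1 h, pairing_sum_smul]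
    refine Finset.sum_le_sum fun z _ => mul_le_mul_of_nonneg_left
      ((pairing_vecMulVec_le hx hy _ _).trans_eq ?_) (mul_nonneg (hs _) (hs _))
    rw [sum_norm_extend_sq, sum_norm_extend_sq]
    simp only [Pi.star_apply, norm_star, hnu, hnv]
    split_ifs
    · rw [← Real.sqrt_mul (by positivity), hK]
      simp
    · simp
  -- Every pair counts once, and each diagonal pair an extra `K - 1`.
  have hc : ∑ z : ι × ι, s z.1 * s z.2 * (if z.1 = z.2 then K else 1) =
      (K - 1) * ∑ r, s r ^ 2 + (∑ r, s r) ^ 2 := by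
    rw [sq (∑ r, s r), Finset.sum_mul_sum, Finset.mul_sum, ← Finset.sum_add_distrib,
      Fintype.sum_prod_type]
    refine Finset.sum_congr rfl fun r _ => ?_
    rw [← sub_eq_iff_eq_add, ← Finset.sum_sub_distrib, Finset.sum_eq_single r]
    · simp
      ring
    · intro t _ ht
      simp [ht.symm]
    · simp
  rw [hc, h1] at hb
  linarith

end pure

/-- Both sides are off-diagonal sums: `∑_{r ≠ t} s r * s t` on the left, and `∑_{r ≠ t} (s r * s t)
^ 2` under the last root. Cauchy–Schwarz links them. -/
theorem sq_sum_sub_one_le {ι : Type} [Fintype ι] {s : ι → ℝ} (h1 : ∑ r, s r ^ 2 = 1)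
    {d : ℕ} (hd : Fintype.card ι ≤ d) :
    (∑ r, s r) ^ 2 - 1 ≤ √((d : ℝ) * (d - 1)) * √(1 - ∑ r, s r ^ 4) := by
  classical
  have hsplit (f : ι → ℝ) : ∑ z ∈ Finset.univ.offDiag, f z.1 * f z.2 =
      (∑ r, f r) ^ 2 - ∑ r, f r ^ 2 := by
    rw [eq_sub_iff_add_eq, sq (∑ r, f r), Finset.sum_mul_sum, ← Finset.sum_product',
      ← Finset.diag_union_offDiag, Finset.sum_union (Finset.disjoint_diag_offDiag _), add_comm]
    simp [Finset.sum_diag, sq]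
  have hA := hsplit s
  have hB := hsplit fun r => s r ^ 2
  simp only [h1, ← pow_mul, one_pow] at hA hB
  norm_num at hB
  have hcard : ((Finset.univ : Finset ι).offDiag.card : ℝ) ≤ d * (d - 1) := by
    have hc : (Finset.univ : Finset ι).offDiag.card ≤ d * (d - 1) := by
      rw [Finset.offDiag_card, Finset.card_univ, ← Nat.mul_sub_one]
      exact Nat.mul_le_mul hd (Nat.sub_le_sub_right hd 1)
    -- Truncated `d - 1` agrees with the real one only for `d > 0`; at `d = 0` the factor `d` kills
    -- both products.
    rcases Nat.eq_zero_or_pos d with rfl | h0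
    · simpa using hc
    · have := (Nat.cast_le (α := ℝ)).2 hc
      rwa [Nat.cast_mul, Nat.cast_pred h0] at this
  have hcs := sq_sum_le_card_mul_sum_sq (s := (Finset.univ : Finset ι).offDiag)
    (f := fun z => s z.1 * s z.2)
  simp only [mul_pow] at hcs
  have hnn : 0 ≤ 1 - ∑ r, s r ^ 4 := hB ▸ Finset.sum_nonneg fun z _ => by positivity
  rw [hA, hB] at hcs
  have hd0 : (0 : ℝ) ≤ d * (d - 1) := le_trans (by positivity) hcard
  rw [← Real.sqrt_mul hd0]
  exact Real.le_sqrt_of_sq_le (hcs.trans (mul_le_mul_of_nonneg_right hcard hnn))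

/-! ### From pure to mixed states. -/

theorem le_pureConcurrence {d : ℕ} (hd : d = min dA dB) (hd2 : 2 ≤ d) (α β : ℝ) (l : ℕ)
    {κ : Type} [Fintype κ]
    {x : κ → EuclideanSpace ℂ (Fin l ⊕ Fin dA × Fin dA)}
    {y : κ → EuclideanSpace ℂ (Fin l ⊕ Fin dB × Fin dB)} (hx : Orthonormal ℂ x)
    (hy : Orthonormal ℂ y) {φ : EuclideanSpace ℂ (Fin dA × Fin dB)} (hφ : ‖φ‖ = 1) :
    √2 / √((d : ℝ) * (d - 1)) *
      (pairing x y (M α β l (proj φ)) - √((l * α ^ 2 + 1) * (l * β ^ 2 + 1))) ≤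
      pureConcurrence φ := by
  obtain ⟨ι, _, s, u, v, hs, hu, hv, h, h1, hc⟩ := exists_schmidt φ hφ
  have hb := (pairing_M_proj_le hx hy α β hs hu hv h1 h).trans (sq_sum_sub_one_le h1 (hd ▸ hc))
  have hd2' : (2 : ℝ) ≤ d := by exact_mod_cast hd2
  have hpos : 0 < √((d : ℝ) * (d - 1)) := Real.sqrt_pos.2 (by nlinarith)
  rw [pureConcurrence, trace_ptraceB_proj_sq hu hv h, Real.sqrt_mul zero_le_two, div_mul_eq_mul_div,
    div_le_iff₀ hpos, mul_assoc, mul_comm √(1 - _)]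
  exact mul_le_mul_of_nonneg_left hb (Real.sqrt_nonneg _)

/-- The constant corner makes `M` affine rather than linear, so the weights must sum to `1`. -/
theorem M_sum_smul (α β : ℝ) (l : ℕ) {n : ℕ} {p : Fin n → ℝ} (hp : ∑ i, p i = 1)
    (Z : Fin n → Matrix (Fin dA × Fin dB) (Fin dA × Fin dB) ℂ) :
    M α β l (∑ i, (p i : ℂ) • Z i) = ∑ i, (p i : ℂ) • M α β l (Z i) := by
  have hp' : (∑ i, (p i : ℂ)) = 1 := by exact_mod_cast hp
  ext (a | ⟨a₁, a₂⟩) (b | ⟨b₁, b₂⟩)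
  · simp [M, Matrix.sum_apply, ← Finset.sum_mul, hp']
  · simp only [M, omega, ptraceA, Matrix.vec, Matrix.sum_apply, Matrix.smul_apply,
      Matrix.fromBlocks_apply₁₂, Matrix.transpose_apply, Matrix.of_apply, smul_eq_mul,
      Finset.mul_sum]
    rw [Finset.sum_comm]
    exact Finset.sum_congr rfl fun i _ => Finset.sum_congr rfl fun j _ => by ring
  · simp only [M, omega, ptraceB, Matrix.vec, Matrix.sum_apply, Matrix.smul_apply,
      Matrix.fromBlocks_apply₂₁, Matrix.of_apply, smul_eq_mul, Finset.mul_sum]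
    rw [Finset.sum_comm]
    exact Finset.sum_congr rfl fun i _ => Finset.sum_congr rfl fun j _ => by ring
  · simp only [M, realign, block, Matrix.vec, Matrix.sum_apply, Matrix.smul_apply,
      Matrix.fromBlocks_apply₂₂, Matrix.of_apply]

end Bipartite
end

theorem theorem2 (dA dB d : ℕ) (hd : d = min dA dB) (hd2 : 2 ≤ d) (α β : ℝ) (l : ℕ)
    (ρ : Matrix (Fin dA × Fin dB) (Fin dA × Fin dB) ℂ) (hρ : Bipartite.IsDensity ρ) :
    Bipartite.concurrence ρ ≥
      √2 / √((d : ℝ) * ((d : ℝ) - 1)) *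
        (Bipartite.traceNorm (Bipartite.M α β l ρ)
          - √(((l : ℝ) * α ^ 2 + 1) * ((l : ℝ) * β ^ 2 + 1))) := by
  -- Nonemptiness is essential: the real `sInf` of the empty set is `0`.
  refine le_csInf (Bipartite.averages_nonempty hρ) ?_
  rintro c ⟨n, p, φ, hE, rfl⟩
  -- The partial isometry is chosen for `ρ` and reused for every `φ i`, which takes the place of the
  -- triangle inequality for `traceNorm`.
  obtain ⟨κ, _, x, y, hx, hy, hxy⟩ :=
    Bipartite.exists_traceNorm_eq_pairing (Bipartite.M α β l ρ)
  set K := √(((l : ℝ) * α ^ 2 + 1) * ((l : ℝ) * β ^ 2 + 1))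
  have h1 : Bipartite.traceNorm (Bipartite.M α β l ρ) - K =
      ∑ i, p i * (Bipartite.pairing x y (Bipartite.M α β l (Bipartite.proj (φ i))) - K) := by
    rw [hxy, hE.sum_proj, Bipartite.M_sum_smul α β l hE.sum_eq_one, Bipartite.pairing_sum_smul]
    simp only [mul_sub, Finset.sum_sub_distrib, ← Finset.sum_mul, hE.sum_eq_one, one_mul]
  rw [h1, Finset.mul_sum]
  refine Finset.sum_le_sum fun i _ => ?_
  rw [mul_left_comm]
  exact mul_le_mul_of_nonneg_left
    (Bipartite.le_pureConcurrence hd hd2 α β l hx hy (hE.norm_eq_one i)) (hE.nonneg i)
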